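/- Let $N\ge 2$, $s\ge 3$, and let $K_1,\dots,K_s\subset\mathbb{R}^N$ be nonempty, pairwise disjoint, compact, strictly convex sets with $C^2$-smooth boundaries that satisfy the no-eclipse condition: the convex hull of $K_i\cup K_j$ does not meet $K_k$ whenever $k\ne i$ and $k\ne j$. Consider the billiard in the exterior of $K=K_1\cup\dots\cup K_s$. Its phase space consists of the pairs $(x,v)$ with $x\in\partial K$, $\|v\|=1$ and $\langle \nu(x),v\rangle>0$, where $\nu(x)$ is the unit normal to $\partial K$ at $x$ pointing out of $K$; the billiard ball map $B$ sends $(x,v)$ to $(y,u)$, where $y$ is the first point at which the ray from $x$ in direction $v$ meets $\partial K$ again and $u=v-2\langle v,\nu(y)\rangle\nu(y)$, provided that $y$ exists and $(y,u)$ lies in the phase space. Let $\Sigma$ be the set of all bi-infinite sequences $\xi=(\xi_i)_{i\in\mathbb{Z}}$ in $\{1,\dots,s\}$ with $\xi_i\ne\xi_{i+1}$ for all $i$, and let $\sigma:\Sigma\to\Sigma$, $(\sigma\xi)_i=\xi_{i+1}$, be the left shift. For every $\xi\in\Sigma$ there is exactly one phase point $(y,v)$ such that $B^i(y,v)$ is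 defined and has its base point on $\partial K_{\xi_i}$ for every $i\in\mathbb{Z}$; put $\phi(\xi)=y$. Let the general rotation set $G_\phi$ be the set of all $\rho\in\mathbb{R}^N$ for which there are $\xi\in\Sigma$ and integers $n_1<n_2<\cdots$ with $$\rho=\lim_{k\to\infty}\frac{1}{n_k}\sum_{i=0}^{n_k-1}\phi(\sigma^i\xi),$$ and let $P_\phi$ be the set of all convex combinations $\sum_{j=1}^k t_j\rho_j$ ($t_j\ge 0$, $\sum_j t_j=1$) of rotation vectors $\rho_j=\lim_{n\to\infty}\frac1n\sum_{i=0}^{n-1}\phi(\sigma^i\xi^{(j)})$ of sequences $\xi^{(j)}\in\Sigma$ that are periodic under $\sigma$. Then $G_\phi$ is convex, and $P_\phi$ is a dense subset of $G_\phi$; that is, $P_\phi\subset G_\phi\subset\overline{P_\phi}$. -/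

import Mathlib

open Set Filter Topology

namespace OpenBilliard

/-- `N`-dimensional Euclidean space. -/
abbrev Euc (N : ℕ) : Type := EuclideanSpace ℝ (Fin N)

/-- `f` is a local `C²` defining function of the set `S` at `x`: near `x` it is `C²` with
`S = {f ≤ 0}`, and its gradient at `x` does not vanish. -/
structure IsDefiningFunction {N : ℕ} (S : Set (Euc N)) (x : Euc N) (f : Euc N → ℝ) : Prop where
  contDiffAt : ContDiffAt ℝ 2 f x
  gradient_ne_zero : gradient f x ≠ 0
  mem_iff : ∀ᶠ y in 𝓝 x, y ∈ S ↔ f y ≤ 0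

/-- `S` has a `C²`-smooth boundary. -/
def HasC2Boundary {N : ℕ} (S : Set (Euc N)) : Prop :=
  ∀ x ∈ frontier S, ∃ f : Euc N → ℝ, IsDefiningFunction S x f

/-- `ν` is the unit normal to the boundary of `S` at the boundary point `x` that points
out of `S`. -/
def IsOuterUnitNormal {N : ℕ} (S : Set (Euc N)) (x ν : Euc N) : Prop :=
  x ∈ frontier S ∧ ‖ν‖ = 1 ∧
    ∃ f : Euc N → ℝ, IsDefiningFunction S x f ∧ ∃ c : ℝ, 0 < c ∧ gradient f x = c • ν

/-- The standing assumptions on the obstacles `K 0, …, K (s - 1)`: nonempty, compact, strictly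
convex sets with `C²` boundaries, pairwise disjoint and without eclipse. -/
structure IsOpenBilliard {N s : ℕ} (K : Fin s → Set (Euc N)) : Prop where
  nonempty : ∀ i, (K i).Nonempty
  isCompact : ∀ i, IsCompact (K i)
  strictConvex : ∀ i, StrictConvex ℝ (K i)
  hasC2Boundary : ∀ i, HasC2Boundary (K i)
  pairwiseDisjoint : Pairwise fun i j => Disjoint (K i) (K j)
  noEclipse : ∀ i j k, k ≠ i → k ≠ j → Disjoint (convexHull ℝ (K i ∪ K j)) (K k)

/-- The union of the obstacles; the billiard domain is its complement. -/
def obstacle {N s : ℕ} (K : Fin s → Set (Euc N)) : Set (Euc N) := ⋃ i, K i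

/-- The phase space `M`: pairs `(x, v)` of a boundary point `x` and a unit vector `v` with
`⟪ν(x), v⟫ > 0`, where `ν(x)` is the unit normal pointing into the billiard domain. -/
def phaseSpace {N s : ℕ} (K : Fin s → Set (Euc N)) : Set (Euc N × Euc N) :=
  {q | ‖q.2‖ = 1 ∧ ∃ ν, IsOuterUnitNormal (obstacle K) q.1 ν ∧ 0 < inner ℝ ν q.2}

/-- The graph of the billiard ball map `B`: `BallMap K (x, v) (y, u)` holds if the ray issued
from `x` in direction `v` first meets the boundary at `y`, and `u` is the reflection of `v` in
the tangent hyperplane at `y`. -/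
def BallMap {N s : ℕ} (K : Fin s → Set (Euc N)) (q q' : Euc N × Euc N) : Prop :=
  q ∈ phaseSpace K ∧ q' ∈ phaseSpace K ∧
    (∃ t : ℝ, 0 < t ∧ q'.1 = q.1 + t • q.2) ∧
    Disjoint (openSegment ℝ q.1 q'.1) (frontier (obstacle K)) ∧
    ∃ ν, IsOuterUnitNormal (obstacle K) q'.1 ν ∧ q'.2 = q.2 - (2 * inner ℝ q.2 ν) • ν

/-- The symbol space: bi-infinite sequences of symbols in which neighbours differ. -/
def SymbolSpace (s : ℕ) : Type := {ξ : ℤ → Fin s // ∀ i, ξ i ≠ ξ (i + 1)}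

/-- The left shift on the symbol space. -/
def shift {s : ℕ} (ξ : SymbolSpace s) : SymbolSpace s :=
  ⟨fun i => ξ.1 (i + 1), fun i => ξ.2 (i + 1)⟩

/-- The trajectory of the phase point `q` is coded by `ξ`: it has reflections for all times
`i ∈ ℤ`, and the `i`-th one takes place on the boundary of `K (ξ i)`. -/
def IsCodedBy {N s : ℕ} (K : Fin s → Set (Euc N)) (ξ : SymbolSpace s) (q : Euc N × Euc N) :
    Prop :=
  ∃ o : ℤ → Euc N × Euc N, o 0 = q ∧
    ∀ i, BallMap K (o i) (o (i + 1)) ∧ (o i).1 ∈ frontier (K (ξ.1 i))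

/-- The coding map: `ξ` is sent to the phase point `(y, v)` whose trajectory is coded by `ξ`.
(The theorem includes that there is exactly one such point for every `ξ`.) -/
noncomputable def coding {N s : ℕ} (K : Fin s → Set (Euc N)) (ξ : SymbolSpace s) :
    Euc N × Euc N :=
  Classical.epsilon (IsCodedBy K ξ)

/-- The observable: the starting point (the `0`-th reflection point) of the trajectory coded
by `ξ`. -/
noncomputable def observable {N s : ℕ} (K : Fin s → Set (Euc N)) (ξ : SymbolSpace s) : Euc N :=
  (coding K ξ).1

/-- `ρ` is the rotation vector of `ξ` for `φ`: the limit of the averages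
`(1 / n) * ∑ i < n, φ (σ^i ξ)`. -/
def HasRotationVector {N s : ℕ} (φ : SymbolSpace s → Euc N) (ξ : SymbolSpace s) (ρ : Euc N) :
    Prop :=
  Tendsto (fun n : ℕ => birkhoffAverage ℝ shift φ n ξ) atTop (𝓝 ρ)

/-- The general rotation set of `φ`: all limits of subsequences of sequences of averages
`(1 / n) * ∑ i < n, φ (σ^i ξ)`, for all `ξ`. -/
def generalRotationSet {N s : ℕ} (φ : SymbolSpace s → Euc N) : Set (Euc N) :=
  {ρ | ∃ ξ : SymbolSpace s, ∃ n : ℕ → ℕ, StrictMono n ∧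
    Tendsto (fun k : ℕ => birkhoffAverage ℝ shift φ (n k) ξ) atTop (𝓝 ρ)}

/-- The set of all convex combinations of rotation vectors of periodic sequences. -/
def periodicConvexCombinations {N s : ℕ} (φ : SymbolSpace s → Euc N) : Set (Euc N) :=
  convexHull ℝ {ρ | ∃ ξ ∈ Function.periodicPts (shift : SymbolSpace s → SymbolSpace s),
    HasRotationVector φ ξ ρ}

end OpenBilliard

/-!
The proof has a geometric and a symbolic half, linked by the continuity of the coding.

**Coding.** The reflection points of a trajectory coded by `ξ` form a *minimal chain*: each
`x i ∈ K (ξ i)` minimises the length of the path through its two neighbours among the points of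
`K (ξ i)`. By convexity this is equivalent to the first-order condition that the change of direction
at `x i` is a normal vector of `K (ξ i)` (`isMinimalChain_iff`). With the no-eclipse condition, which
makes the turns nonzero and the free segments unobstructed, this is the reflection law, so coded
trajectories and minimal chains correspond (`IsCodedBy.exists_isMinimalChain`,
`IsMinimalChain.isCodedBy`). Chains exist by minimising the length over finite windows and passing
to the limit by compactness (`exists_isMinimalChain`). Uniqueness does not need hyperbolicity: for
two chains `x`, `y` with directions `v`, `w` the quantity `⟪v i - w i, x i - y i⟫` does not decrease
with `i`, and it increases strictly when points differ (`separation_le_succ`). As a continuous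
function on the compact, shift-invariant set of all pairs of chains it attains a maximum and a
minimum, and both must then be `0` (`IsMinimalChain.unique`). Since the set of all chains is
compact, uniqueness also yields the continuity of the coding (`continuous_observable`).

**Rotation sets.** Let `φ` be any continuous observable on the symbol space, and `s ≥ 3`. Any two
words can be joined by one extra symbol, and any word can be repeated periodically with one extra
symbol; both change the Birkhoff sums by `o(n)` only. Repeating long words shows that the general
rotation set lies in the closure of the set of rotation vectors of periodic sequences, and joining
words shows that this closure is convex. Conversely, for `ρ` in the closure the sequences with
arbitrarily long averages arbitrarily close to `ρ` form a dense `Gδ` set, which is nonempty by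
Baire's theorem. Hence the general rotation set equals that closure
(`generalRotationSet_eq_closure`), and the claims follow.
-/

open Set Filter Topology

namespace OpenBilliard

/-! ### The symbol space -/

/-- The product topology on the symbol space, the alphabet being discrete. -/
instance (s : ℕ) : TopologicalSpace (SymbolSpace s) :=
  inferInstanceAs (TopologicalSpace {ξ : ℤ → Fin s // ∀ i, ξ i ≠ ξ (i + 1)})

instance (s : ℕ) : T2Space (SymbolSpace s) :=
  inferInstanceAs (T2Space {ξ : ℤ → Fin s // ∀ i, ξ i ≠ ξ (i + 1)})

instance (s : ℕ) : CompactSpace (SymbolSpace s) := by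
  refine isCompact_iff_compactSpace.mp (IsClosed.isCompact (s := {ξ : ℤ → Fin s | _}) ?_)
  rw [ofPred_forall]
  refine isClosed_iInter fun i => ?_
  have h : Continuous fun ξ : ℤ → Fin s => (ξ i, ξ (i + 1)) := by fun_prop
  exact (isClosed_discrete {p : Fin s × Fin s | p.1 ≠ p.2}).preimage h

variable {N s : ℕ}

lemma continuous_symbol (i : ℤ) : Continuous fun ξ : SymbolSpace s => ξ.1 i :=
  (continuous_apply i).comp continuous_subtype_val

lemma SymbolSpace.ext {ξ η : SymbolSpace s} (h : ∀ i, ξ.1 i = η.1 i) : ξ = η :=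
  Subtype.ext (funext h)

lemma continuous_shift : Continuous (shift : SymbolSpace s → SymbolSpace s) :=
  Continuous.subtype_mk (continuous_pi fun i => continuous_symbol (i + 1)) _

lemma shift_iterate_apply (k : ℕ) (ξ : SymbolSpace s) (i : ℤ) :
    (shift^[k] ξ).1 i = ξ.1 (i + k) := by
  induction k generalizing i with
  | zero => simp
  | succ k ih =>
    rw [Function.iterate_succ_apply']
    change (shift^[k] ξ).1 (i + 1) = _
    rw [ih]
    push_cast
    ring_nf

lemma exists_ne_ne (hs : 3 ≤ s) (a b : Fin s) : ∃ c, c ≠ a ∧ c ≠ b := by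
  by_contra! h
  have h1 : (Finset.univ : Finset (Fin s)) ⊆ {a, b} := fun c _ => by
    by_cases hc : c = a
    · simp [hc]
    · simp [h c hc]
  have h2 := (Finset.card_le_card h1).trans Finset.card_le_two
  rw [Finset.card_univ, Fintype.card_fin] at h2
  omega

/-- The left half of `ξ` and the right half of `η` can be joined by one further symbol. -/
lemma exists_join (hs : 3 ≤ s) (ξ η : SymbolSpace s) (a : ℤ) :
    ∃ ζ : SymbolSpace s, (∀ i < a, ζ.1 i = ξ.1 i) ∧ ∀ i, 0 ≤ i → ζ.1 (a + 1 + i) = η.1 i := by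
  obtain ⟨c, hc1, hc2⟩ := exists_ne_ne hs (ξ.1 (a - 1)) (η.1 0)
  refine ⟨⟨fun i => if i < a then ξ.1 i else if i = a then c else η.1 (i - a - 1), fun i => ?_⟩,
    fun i hi => by simp [hi], fun i hi => ?_⟩
  · dsimp only
    rcases lt_trichotomy i a with h | h | h
    · rcases (show i + 1 ≤ a by omega).lt_or_eq with h' | h'
      · rw [if_pos h, if_pos h']
        exact ξ.2 i
      · rw [if_pos h, if_neg (by omega), if_pos h', show i = a - 1 by omega]
        exact hc1.symm
    · subst h
      rw [if_neg (by omega), if_pos rfl, if_neg (by omega), if_neg (by omega)]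
      simpa using hc2
    · rw [if_neg (by omega), if_neg (by omega), if_neg (by omega), if_neg (by omega),
        show i + 1 - a - 1 = i - a - 1 + 1 by ring]
      exact η.2 _
  · dsimp only
    rw [if_neg (by omega), if_neg (by omega)]
    ring_nf

/-- Every word of length `n ≥ 1` extends to a periodic sequence of period `n + 1`. -/
lemma exists_periodic (hs : 3 ≤ s) (ξ : SymbolSpace s) {n : ℕ} (hn : 1 ≤ n) :
    ∃ ζ : SymbolSpace s, Function.IsPeriodicPt shift (n + 1) ζ ∧
      ∀ i : ℤ, 0 ≤ i → i < n → ζ.1 i = ξ.1 i := by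
  obtain ⟨c, hc1, hc2⟩ := exists_ne_ne hs (ξ.1 (n - 1)) (ξ.1 0)
  have hpos : (0 : ℤ) < n + 1 := by omega
  obtain ⟨ζ, hζ⟩ : ∃ ζ : SymbolSpace s, ∀ i,
      ζ.1 i = if i % (n + 1) < n then ξ.1 (i % (n + 1)) else c := by
    refine ⟨⟨fun i => if i % (n + 1) < n then ξ.1 (i % (n + 1)) else c, fun i => ?_⟩,
      fun i => rfl⟩
    dsimp only
    have h0 := Int.emod_nonneg i hpos.ne'
    have h1 := Int.emod_lt_of_pos i hpos
    have h2 := Int.emod_add_mul_ediv i (n + 1)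
    set r := i % ((n : ℤ) + 1)
    have h3 : i + 1 = r + 1 + (n + 1) * (i / (n + 1)) := by linarith
    have h4 : (i + 1) % ((n : ℤ) + 1) = (r + 1) % (n + 1) := by
      rw [h3, Int.add_mul_emod_self_left]
    rw [h4]
    rcases (show r ≤ n by omega).lt_or_eq with h | h
    · rw [if_pos h, Int.emod_eq_of_lt (by omega) (by omega)]
      rcases (show r + 1 ≤ n by omega).lt_or_eq with h' | h'
      · rw [if_pos h']
        exact ξ.2 r
      · rw [if_neg (by omega), show r = n - 1 by omega]
        exact hc1.symm
    · rw [if_neg (by omega), h, Int.emod_self, if_pos (by omega)]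
      exact hc2
  refine ⟨ζ, SymbolSpace.ext fun i => ?_, fun i h0 h1 => ?_⟩
  · rw [shift_iterate_apply, hζ, hζ]
    simp
  · rw [hζ, Int.emod_eq_of_lt h0 (by omega), if_pos h1]

/-! ### Birkhoff sums of continuous observables -/

section Birkhoff

variable {φ : SymbolSpace s → Euc N}

lemma exists_norm_le (hφ : Continuous φ) : ∃ B, 0 ≤ B ∧ ∀ ξ, ‖φ ξ‖ ≤ B := by
  obtain ⟨B, hB⟩ := isCompact_univ.exists_bound_of_continuousOn hφ.continuousOn
  exact ⟨max B 0, le_max_right _ _, fun ξ => (hB ξ (mem_univ _)).trans (le_max_left _ _)⟩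

lemma exists_window_dist_le (hφ : Continuous φ) {ε : ℝ} (hε : 0 < ε) :
    ∃ m : ℕ, ∀ ξ η : SymbolSpace s, (∀ i : ℤ, |i| ≤ m → ξ.1 i = η.1 i) →
      dist (φ ξ) (φ η) ≤ ε := by
  by_contra! h
  let t : ℕ → Set (SymbolSpace s × SymbolSpace s) := fun m =>
    {p | (∀ i : ℤ, |i| ≤ m → p.1.1 i = p.2.1 i) ∧ ε ≤ dist (φ p.1) (φ p.2)}
  have hclosed : ∀ m, IsClosed (t m) := fun m => by
    have h1 : IsClosed {p : SymbolSpace s × SymbolSpace s |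
        ∀ i : ℤ, |i| ≤ m → p.1.1 i = p.2.1 i} := by
      simp only [ofPred_forall]
      exact isClosed_iInter fun i => isClosed_iInter fun _ => isClosed_eq
        ((continuous_symbol i).comp continuous_fst) ((continuous_symbol i).comp continuous_snd)
    exact h1.inter (isClosed_le continuous_const
      ((hφ.comp continuous_fst).dist (hφ.comp continuous_snd)))
  obtain ⟨⟨ξ, η⟩, hp⟩ := IsCompact.nonempty_iInter_of_sequence_nonempty_isCompact_isClosed t
    (fun m p hp => ⟨fun i hi => hp.1 i (hi.trans (by push_cast; linarith)), hp.2⟩)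
    (fun m => by obtain ⟨ξ, η, h1, h2⟩ := h m; exact ⟨(ξ, η), h1, h2.le⟩)
    (hclosed 0).isCompact hclosed
  rw [mem_iInter] at hp
  have he : ξ = η := SymbolSpace.ext fun i => (hp i.natAbs).1 i (by simp)
  have h2 : ε ≤ dist (φ ξ) (φ η) := (hp 0).2
  rw [he, dist_self] at h2
  linarith

/-- The Birkhoff sums of length `n` of two sequences that agree on `[0, n)` differ by `o(n)`,
uniformly in the sequences: only the terms near the two ends of the window can be far apart. -/
lemma exists_birkhoffSum_sub_le (hφ : Continuous φ) {ε : ℝ} (hε : 0 < ε) :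
    ∃ C, 0 ≤ C ∧ ∀ (ξ η : SymbolSpace s) (n : ℕ),
      (∀ i : ℤ, 0 ≤ i → i < n → ξ.1 i = η.1 i) →
      ‖birkhoffSum shift φ n ξ - birkhoffSum shift φ n η‖ ≤ n * ε + C := by
  obtain ⟨B, hB0, hB⟩ := exists_norm_le hφ
  obtain ⟨m, hm⟩ := exists_window_dist_le hφ hε
  refine ⟨m * (2 * B) + m * (2 * B), by positivity, fun ξ η n h => ?_⟩
  rw [← dist_eq_norm]
  have hterm : ∀ k ∈ Finset.range n, dist (φ (shift^[k] ξ)) (φ (shift^[k] η)) ≤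
      ε + ((if k < m then 2 * B else 0) + (if n ≤ k + m then 2 * B else 0)) := by
    intro k hk
    rw [Finset.mem_range] at hk
    have hbig : dist (φ (shift^[k] ξ)) (φ (shift^[k] η)) ≤ 2 * B := by
      rw [dist_eq_norm]
      refine (norm_sub_le _ _).trans ?_
      linarith [hB (shift^[k] ξ), hB (shift^[k] η)]
    by_cases h1 : k < m
    · rw [if_pos h1]
      split_ifs <;> linarith
    · by_cases h2 : n ≤ k + m
      · rw [if_neg h1, if_pos h2]
        linarith
      · rw [if_neg h1, if_neg h2, add_zero, add_zero]
        refine hm _ _ fun i hi => ?_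
        rw [abs_le] at hi
        rw [shift_iterate_apply, shift_iterate_apply]
        exact h _ (by omega) (by omega)
  refine (dist_birkhoffSum_birkhoffSum_le _ _ _ _ _).trans ((Finset.sum_le_sum hterm).trans ?_)
  have hc1 : (Finset.card ((Finset.range n).filter (· < m)) : ℝ) ≤ m := by
    have : ((Finset.range n).filter (· < m)) ⊆ Finset.range m := fun k hk => by
      simp at hk ⊢; omega
    exact_mod_cast (Finset.card_le_card this).trans (by simp)
  have hc2 : (Finset.card ((Finset.range n).filter (n ≤ · + m)) : ℝ) ≤ m := by
    have : ((Finset.range n).filter (n ≤ · + m)) ⊆ Finset.Ico (n - m) n := fun k hk => by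
      simp at hk ⊢; omega
    exact_mod_cast (Finset.card_le_card this).trans (by rw [Nat.card_Ico]; omega)
  rw [Finset.sum_add_distrib, Finset.sum_add_distrib, ← Finset.sum_filter, ← Finset.sum_filter,
    Finset.sum_const, Finset.sum_const, Finset.sum_const, Finset.card_range]
  simp only [nsmul_eq_mul]
  gcongr

/-- A form of specification: the Birkhoff sums of the joined sequence are, up to `o(n)`, the sums
of the two Birkhoff sums. -/
lemma exists_join_birkhoffSum (hs : 3 ≤ s) (hφ : Continuous φ) {ε : ℝ} (hε : 0 < ε) :
    ∃ C, 0 ≤ C ∧ ∀ (ξ η : SymbolSpace s) (a : ℕ), ∃ ζ : SymbolSpace s,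
      (∀ i < (a : ℤ), ζ.1 i = ξ.1 i) ∧ ∀ b : ℕ,
      ‖birkhoffSum shift φ (a + 1 + b) ζ - birkhoffSum shift φ a ξ - birkhoffSum shift φ b η‖
        ≤ (a + b) * ε + C := by
  obtain ⟨B, hB0, hB⟩ := exists_norm_le hφ
  obtain ⟨C, hC0, hC⟩ := exists_birkhoffSum_sub_le hφ hε
  refine ⟨C + C + B, by positivity, fun ξ η a => ?_⟩
  obtain ⟨ζ, h1, h2⟩ := exists_join hs ξ η a
  refine ⟨ζ, h1, fun b => ?_⟩
  have e1 := hC ζ ξ a fun i _ hi => h1 i hi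
  have e2 := hC (shift^[a + 1] ζ) η b fun i hi _ => by
    rw [shift_iterate_apply, ← h2 i hi]
    push_cast
    ring_nf
  rw [birkhoffSum_add, birkhoffSum_succ]
  calc _ = ‖(birkhoffSum shift φ a ζ - birkhoffSum shift φ a ξ) + φ (shift^[a] ζ) +
        (birkhoffSum shift φ b (shift^[a + 1] ζ) - birkhoffSum shift φ b η)‖ := by
        congr 1; abel
    _ ≤ (a * ε + C) + B + (b * ε + C) :=
        norm_add_le_of_le (norm_add_le_of_le e1 (hB _)) e2
    _ = _ := by ring

lemma norm_birkhoffAverage_sub {n : ℕ} (hn : 1 ≤ n) (ξ : SymbolSpace s) (ρ : Euc N) :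
    ‖birkhoffAverage ℝ shift φ n ξ - ρ‖ = ‖birkhoffSum shift φ n ξ - (n : ℝ) • ρ‖ / n := by
  have hn' : (n : ℝ) ≠ 0 := by positivity
  rw [birkhoffAverage, show (n : ℝ)⁻¹ • birkhoffSum shift φ n ξ - ρ =
    (n : ℝ)⁻¹ • (birkhoffSum shift φ n ξ - (n : ℝ) • ρ) by
      rw [smul_sub, inv_smul_smul₀ hn'], norm_smul, norm_inv, Real.norm_natCast, div_eq_inv_mul]

lemma hasRotationVector_of_bounded {ξ : SymbolSpace s} {ρ : Euc N} {D : ℝ}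
    (h : ∀ n : ℕ, ‖birkhoffSum shift φ n ξ - (n : ℝ) • ρ‖ ≤ D) : HasRotationVector φ ξ ρ := by
  rw [HasRotationVector, tendsto_iff_norm_sub_tendsto_zero]
  refine squeeze_zero' (Eventually.of_forall fun n => norm_nonneg _) ?_
    (tendsto_const_div_atTop_nhds_zero_nat D)
  filter_upwards [eventually_ge_atTop 1] with n hn
  rw [norm_birkhoffAverage_sub hn]
  gcongr
  exact h n

/-- The Birkhoff sums of a periodic sequence stay within bounded distance of `n` times the average
over a period. -/
lemma exists_bound_of_isPeriodicPt {ξ : SymbolSpace s} {p : ℕ}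
    (hp : 0 < p) (h : Function.IsPeriodicPt shift p ξ) :
    ∃ D, ∀ n : ℕ, ‖birkhoffSum shift φ n ξ - (n : ℝ) • birkhoffAverage ℝ shift φ p ξ‖ ≤ D := by
  set ρ := birkhoffAverage ℝ shift φ p ξ with hρ
  have hper : Function.Periodic (fun n : ℕ => birkhoffSum shift φ n ξ - (n : ℝ) • ρ) p := by
    intro n
    have hp' : (p : ℝ) ≠ 0 := by positivity
    have : (p : ℝ) • ρ = birkhoffSum shift φ p ξ := by
      rw [hρ, birkhoffAverage, smul_inv_smul₀ hp']
    dsimp only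
    rw [add_comm n p, birkhoffSum_add, h.eq, ← this]
    push_cast
    rw [add_smul]
    abel
  refine ⟨∑ k ∈ Finset.range p, ‖birkhoffSum shift φ k ξ - (k : ℝ) • ρ‖, fun n => ?_⟩
  rw [← hper.map_mod_nat n]
  exact Finset.single_le_sum (f := fun k : ℕ => ‖birkhoffSum shift φ k ξ - (k : ℝ) • ρ‖)
    (fun _ _ => norm_nonneg _) (Finset.mem_range.2 (Nat.mod_lt n hp))

variable (φ) in
/-- The rotation vectors of periodic sequences. -/
def periodicRotationVectors : Set (Euc N) :=
  {ρ | ∃ ξ ∈ Function.periodicPts (shift : SymbolSpace s → SymbolSpace s),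
    HasRotationVector φ ξ ρ}

lemma exists_bound_of_mem_periodicRotationVectors {ρ : Euc N}
    (h : ρ ∈ periodicRotationVectors φ) :
    ∃ (ξ : SymbolSpace s) (D : ℝ), ∀ n : ℕ, ‖birkhoffSum shift φ n ξ - (n : ℝ) • ρ‖ ≤ D := by
  obtain ⟨ξ, ⟨p, hp, hper⟩, hρ⟩ := h
  obtain ⟨D, hD⟩ := exists_bound_of_isPeriodicPt (φ := φ) hp hper
  rw [tendsto_nhds_unique hρ (hasRotationVector_of_bounded hD)]
  exact ⟨ξ, D, hD⟩

/-- A vector that is, up to `o(n)`, the average of `φ` along arbitrarily long words is a limit of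
rotation vectors of periodic sequences, namely of those that repeat the words. -/
lemma mem_closure_periodicRotationVectors (hs : 3 ≤ s) (hφ : Continuous φ) {ρ : Euc N}
    (h : ∀ ε > 0, ∃ C, ∃ᶠ n : ℕ in atTop, ∃ ξ,
      ‖birkhoffSum shift φ n ξ - (n : ℝ) • ρ‖ ≤ n * ε + C) :
    ρ ∈ closure (periodicRotationVectors φ) := by
  rw [Metric.mem_closure_iff]
  intro ε hε
  obtain ⟨B, hB0, hB⟩ := exists_norm_le hφ
  obtain ⟨C, hC⟩ := h (ε / 4) (by positivity)
  obtain ⟨C', hC0', hC'⟩ := exists_birkhoffSum_sub_le hφ (show 0 < ε / 4 by positivity)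
  obtain ⟨n, ⟨ξ, hξ⟩, hn1, hn⟩ := (hC.and_eventually ((eventually_ge_atTop 1).and
    (tendsto_natCast_atTop_atTop.eventually_gt_atTop ((C + C' + B + ‖ρ‖) / (ε / 4))))).exists
  obtain ⟨ζ, hper, hζ⟩ := exists_periodic hs ξ hn1
  obtain ⟨D, hD⟩ := exists_bound_of_isPeriodicPt (φ := φ) n.succ_pos hper
  refine ⟨_, ⟨ζ, ⟨n + 1, n.succ_pos, hper⟩, hasRotationVector_of_bounded hD⟩, ?_⟩
  have h1 := hC' ζ ξ n hζ
  have hn' : (0 : ℝ) < n := by positivity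
  rw [div_lt_iff₀ (by positivity)] at hn
  rw [dist_comm, dist_eq_norm, norm_birkhoffAverage_sub (by omega), div_lt_iff₀ (by positivity),
    birkhoffSum_succ]
  calc _ = ‖(birkhoffSum shift φ n ζ - birkhoffSum shift φ n ξ) +
        (birkhoffSum shift φ n ξ - (n : ℝ) • ρ) + φ (shift^[n] ζ) - ρ‖ := by
        push_cast
        rw [add_smul, one_smul]
        congr 1; abel
    _ ≤ (n * (ε / 4) + C') + (n * (ε / 4) + C) + B + ‖ρ‖ :=
        norm_sub_le_of_le (norm_add_le_of_le (norm_add_le_of_le h1 hξ) (hB _)) le_rfl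
    _ < _ := by push_cast; nlinarith

lemma convex_closure_periodicRotationVectors (hs : 3 ≤ s) (hφ : Continuous φ) :
    Convex ℝ (closure (periodicRotationVectors φ)) := by
  intro ρ₁ h₁ ρ₂ h₂ t u ht hu htu
  have hcont : Continuous (Function.uncurry fun x y : Euc N => t • x + u • y) := by
    simp only [Function.uncurry_def]; fun_prop
  rw [← closure_closure]
  refine map_mem_closure₂ (f := fun x y : Euc N => t • x + u • y) hcont h₁ h₂ fun x hx y hy => ?_
  obtain ⟨ξ, D, hD⟩ := exists_bound_of_mem_periodicRotationVectors hx
  obtain ⟨η, D', hD'⟩ := exists_bound_of_mem_periodicRotationVectors hy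
  refine mem_closure_periodicRotationVectors hs hφ fun ε hε => ?_
  obtain ⟨C, hC0, hC⟩ := exists_join_birkhoffSum hs hφ hε
  refine ⟨C + D + D' + (‖x‖ + ‖y‖ + ‖t • x + u • y‖), frequently_atTop.2 fun k => ?_⟩
  -- Follow `ξ` for the fraction `t` of the time and `η` for the rest.
  obtain ⟨a, ha1, ha2⟩ : ∃ a : ℕ, (a : ℝ) ≤ t * k ∧ t * k ≤ a + 1 :=
    ⟨⌊t * k⌋₊, Nat.floor_le (by positivity), (Nat.lt_floor_add_one _).le⟩
  have hak : a ≤ k := by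
    have : (a : ℝ) ≤ k := ha1.trans (by nlinarith [(Nat.cast_nonneg k : (0 : ℝ) ≤ k)])
    exact_mod_cast this
  obtain ⟨b, rfl⟩ := Nat.exists_eq_add_of_le hak
  obtain ⟨ζ, -, hζ⟩ := hC ξ η a
  refine ⟨a + 1 + b, by omega, ζ, ?_⟩
  have e3 : ‖((a : ℝ) - t * (a + b)) • x‖ ≤ ‖x‖ := by
    rw [norm_smul, Real.norm_eq_abs]
    refine mul_le_of_le_one_left (norm_nonneg _) (abs_le.2 ?_)
    push_cast at ha1 ha2
    constructor <;> linarith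
  have e4 : ‖((b : ℝ) - u * (a + b)) • y‖ ≤ ‖y‖ := by
    rw [norm_smul, Real.norm_eq_abs]
    refine mul_le_of_le_one_left (norm_nonneg _) (abs_le.2 ?_)
    obtain rfl : u = 1 - t := by linarith
    push_cast at ha1 ha2
    constructor <;> linarith
  calc _ = ‖(birkhoffSum shift φ (a + 1 + b) ζ - birkhoffSum shift φ a ξ
          - birkhoffSum shift φ b η) + (birkhoffSum shift φ a ξ - (a : ℝ) • x)
          + (birkhoffSum shift φ b η - (b : ℝ) • y)
          + (((a : ℝ) - t * (a + b)) • x + ((b : ℝ) - u * (a + b)) • y)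
          - (t • x + u • y)‖ := by
        congr 1
        push_cast
        module
    _ ≤ ((a + b) * ε + C) + D + D' + (‖x‖ + ‖y‖) + ‖t • x + u • y‖ :=
        norm_sub_le_of_le (norm_add_le_of_le (norm_add_le_of_le (norm_add_le_of_le (hζ b) (hD a))
          (hD' b)) (norm_add_le_of_le e3 e4)) le_rfl
    _ ≤ _ := by push_cast; linarith

lemma generalRotationSet_subset_closure (hs : 3 ≤ s) (hφ : Continuous φ) :
    generalRotationSet φ ⊆ closure (periodicRotationVectors φ) := by
  rintro ρ ⟨ξ, n, hn, hlim⟩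
  refine mem_closure_periodicRotationVectors hs hφ fun ε hε => ⟨0, ?_⟩
  refine hn.tendsto_atTop.frequently (Eventually.frequently ?_)
  filter_upwards [hlim.eventually (Metric.closedBall_mem_nhds ρ hε),
    hn.tendsto_atTop.eventually_ge_atTop 1] with k hk hk1
  refine ⟨ξ, ?_⟩
  have hpos : (0 : ℝ) < n k := by positivity
  rwa [dist_eq_norm, norm_birkhoffAverage_sub hk1, div_le_iff₀ hpos, mul_comm,
    ← add_zero ((n k : ℝ) * ε)] at hk

/-- The sequences along which averages of length at least `k` come `1 / (k + 1)`-close to `ρ` form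
a dense open set for each `k`, so by Baire's theorem some sequence has `ρ` as a cluster point of
its averages. -/
lemma closure_subset_generalRotationSet (hs : 3 ≤ s) (hφ : Continuous φ) :
    closure (periodicRotationVectors φ) ⊆ generalRotationSet φ := by
  intro ρ hρ
  let O : ℕ → Set (SymbolSpace s) := fun k =>
    ⋃ n, ⋃ (_ : k ≤ n), {ξ | ‖birkhoffAverage ℝ shift φ n ξ - ρ‖ < 1 / ((k : ℝ) + 1)}
  have hopen : ∀ k, IsOpen (O k) := fun k => by
    refine isOpen_iUnion fun n => isOpen_iUnion fun _ => isOpen_lt (Continuous.norm ?_)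
      continuous_const
    refine Continuous.sub ?_ continuous_const
    have h : Continuous fun ξ => birkhoffSum shift φ n ξ :=
      continuous_finsetSum _ fun i _ => hφ.comp (continuous_shift.iterate i)
    exact h.const_smul (n : ℝ)⁻¹
  have hdense : ∀ k, Dense (O k) := by
    intro k ξ
    obtain ⟨ε, hε⟩ : ∃ ε : ℝ, ε = 1 / ((k : ℝ) + 1) / 4 := ⟨_, rfl⟩
    have hε0 : 0 < ε := by rw [hε]; positivity
    obtain ⟨ρ', hρ', hdist⟩ := Metric.mem_closure_iff.1 hρ ε hε0
    rw [dist_comm, dist_eq_norm] at hdist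
    obtain ⟨η, D, hD⟩ := exists_bound_of_mem_periodicRotationVectors hρ'
    obtain ⟨C, hC0, hC⟩ := exists_join_birkhoffSum hs hφ hε0
    choose ζ hζ1 hζ2 using fun a => hC ξ η a
    have hlim : Tendsto ζ atTop (𝓝 ξ) := by
      refine tendsto_subtype_rng.2 (tendsto_pi_nhds.2 fun i => tendsto_const_nhds.congr' ?_)
      filter_upwards [tendsto_natCast_atTop_atTop.eventually_gt_atTop i] with a ha
      exact (hζ1 a i ha).symm
    refine mem_closure_of_tendsto hlim (Eventually.of_forall fun a => ?_)
    obtain ⟨b, hbk, hb⟩ := ((eventually_ge_atTop k).and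
      (tendsto_natCast_atTop_atTop.eventually_gt_atTop
        ((C + ‖birkhoffSum shift φ a ξ‖ + D + (a + 1) * ‖ρ'‖) / ε))).exists
    refine mem_iUnion₂.2 ⟨a + 1 + b, by omega, ?_⟩
    rw [div_lt_iff₀ hε0] at hb
    have hpos : (0 : ℝ) < (a + 1 + b : ℕ) := by positivity
    rw [mem_ofPred_eq, norm_birkhoffAverage_sub (by omega), div_lt_iff₀ hpos,
      show 1 / ((k : ℝ) + 1) = 4 * ε by rw [hε]; ring]
    calc _ = ‖(birkhoffSum shift φ (a + 1 + b) (ζ a) - birkhoffSum shift φ a ξ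
          - birkhoffSum shift φ b η) + birkhoffSum shift φ a ξ
          + (birkhoffSum shift φ b η - (b : ℝ) • ρ') - ((a : ℝ) + 1) • ρ'
          + ((a + 1 + b : ℕ) : ℝ) • (ρ' - ρ)‖ := by
          congr 1
          push_cast
          module
      _ ≤ ((a + b) * ε + C) + ‖birkhoffSum shift φ a ξ‖ + D + (a + 1) * ‖ρ'‖
          + (a + 1 + b : ℕ) * ε := by
          refine norm_add_le_of_le (norm_sub_le_of_le (norm_add_le_of_le
            (norm_add_le_of_le (hζ2 a b) le_rfl) (hD b)) ?_) ?_
          · rw [norm_smul, Real.norm_of_nonneg (by positivity)]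
          · rw [norm_smul, Real.norm_of_nonneg (by positivity)]
            gcongr
      _ < _ := by
          push_cast
          nlinarith [(Nat.cast_nonneg a : (0 : ℝ) ≤ a), (Nat.cast_nonneg b : (0 : ℝ) ≤ b)]
  have : Nonempty (SymbolSpace s) := by
    obtain ⟨ρ', ξ, -⟩ := closure_nonempty_iff.1 ⟨ρ, hρ⟩
    exact ⟨ξ⟩
  obtain ⟨ξ, hξ⟩ := (dense_iInter_of_isOpen hopen hdense).nonempty
  have hcl : MapClusterPt ρ atTop fun n => birkhoffAverage ℝ shift φ n ξ := by
    rw [mapClusterPt_iff_frequently]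
    intro U hU
    obtain ⟨ε, hε, hball⟩ := Metric.mem_nhds_iff.1 hU
    refine frequently_atTop.2 fun k => ?_
    obtain ⟨j, hj⟩ := exists_nat_one_div_lt hε
    obtain ⟨n, hn, hlt⟩ := mem_iUnion₂.1 (mem_iInter.1 hξ (max j k))
    refine ⟨n, (le_max_right _ _).trans hn, hball (mem_ball_iff_norm.2 (hlt.trans ?_))⟩
    refine lt_of_le_of_lt ?_ hj
    gcongr
    exact le_max_left _ _
  obtain ⟨n, hn, hlim⟩ := hcl.tendsto_subseq
  exact ⟨ξ, n, hn, hlim⟩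

/-- For a continuous observable the general rotation set is the closure of the set of rotation
vectors of periodic sequences. -/
lemma generalRotationSet_eq_closure (hs : 3 ≤ s) (hφ : Continuous φ) :
    generalRotationSet φ = closure (periodicRotationVectors φ) :=
  (generalRotationSet_subset_closure hs hφ).antisymm (closure_subset_generalRotationSet hs hφ)

end Birkhoff

/-! ### Directions and first-order conditions -/

section Direction

variable {E : Type*} [NormedAddCommGroup E] [InnerProductSpace ℝ E]

local notation "⟪" x ", " y "⟫" => inner ℝ x y

/-- The unit vector pointing from `x` to `y`; it is `0` if `x = y`. -/
noncomputable def direction (x y : E) : E := ‖y - x‖⁻¹ • (y - x)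

lemma norm_direction {x y : E} (h : x ≠ y) : ‖direction x y‖ = 1 := by
  have : ‖y - x‖ ≠ 0 := norm_ne_zero_iff.2 (sub_ne_zero.2 h.symm)
  rw [direction, norm_smul, norm_inv, norm_norm, inv_mul_cancel₀ this]

lemma norm_direction_le (x y : E) : ‖direction x y‖ ≤ 1 := by
  by_cases h : x = y
  · simp [direction, h]
  · exact (norm_direction h).le

lemma inner_direction_sub (x y : E) : ⟪direction x y, y - x⟫ = ‖y - x‖ := by
  by_cases h : ‖y - x‖ = 0
  · simp [norm_eq_zero.1 h]
  · rw [direction, real_inner_smul_left, real_inner_self_eq_norm_mul_norm,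
      inv_mul_cancel_left₀ h]

lemma inner_direction_le (x y u : E) : ⟪direction x y, u⟫ ≤ ‖u‖ :=
  (real_inner_le_norm _ _).trans
    (mul_le_of_le_one_left (norm_nonneg _) (norm_direction_le x y))

lemma add_norm_smul_direction (x y : E) : x + ‖y - x‖ • direction x y = y := by
  by_cases h : ‖y - x‖ = 0
  · rw [h, zero_smul, add_zero]
    exact (sub_eq_zero.1 (norm_eq_zero.1 h)).symm
  · rw [direction, smul_inv_smul₀ h, add_sub_cancel]

lemma direction_add_smul {x v : E} {t : ℝ} (ht : 0 < t) (hv : ‖v‖ = 1) :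
    direction x (x + t • v) = v := by
  rw [direction, add_sub_cancel_left, norm_smul, hv, mul_one, Real.norm_of_nonneg ht.le,
    inv_smul_smul₀ ht.ne']

/-- The gradient of the norm is monotone. -/
lemma inner_direction_sub_direction_nonneg (x y x' y' : E) :
    0 ≤ ⟪direction x y - direction x' y', (y - x) - (y' - x')⟫ := by
  have h1 := inner_direction_le x y (y' - x')
  have h2 := inner_direction_le x' y' (y - x)
  have h3 := inner_direction_sub x y
  have h4 := inner_direction_sub x' y'
  rw [inner_sub_left, inner_sub_right _ (y - x), inner_sub_right _ (y - x)]
  linarith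

lemma norm_add_smul_le {a : E} (ha : a ≠ 0) (u : E) (t : ℝ) :
    ‖a + t • u‖ ≤ ‖a‖ + t * ⟪‖a‖⁻¹ • a, u⟫ + t ^ 2 * (‖u‖ ^ 2 / (2 * ‖a‖)) := by
  have ha' : 0 < ‖a‖ := norm_pos_iff.2 ha
  have h1 : ‖a + t • u‖ ^ 2 = ‖a‖ ^ 2 + 2 * (t * ⟪a, u⟫) + t ^ 2 * ‖u‖ ^ 2 := by
    rw [norm_add_sq_real, real_inner_smul_right, norm_smul, mul_pow, Real.norm_eq_abs, sq_abs]
  have h2 := sq_nonneg (‖a + t • u‖ - ‖a‖)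
  rw [real_inner_smul_left]
  have h3 : ‖a‖ + t * (‖a‖⁻¹ * ⟪a, u⟫) + t ^ 2 * (‖u‖ ^ 2 / (2 * ‖a‖)) =
      (‖a + t • u‖ ^ 2 + ‖a‖ ^ 2) / (2 * ‖a‖) := by
    rw [h1]
    field_simp
    ring
  rw [h3, le_div_iff₀ (by positivity)]
  linarith

/-- If `x` minimises the length of the path from `p` to `q` over the points of a convex set, the
first-order condition holds: the change of direction at `x` is a normal vector of the set. -/
lemma inner_direction_sub_nonpos_of_minimal {C : Set E} (hC : Convex ℝ C) {p x q y : E}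
    (hp : p ≠ x) (hq : x ≠ q) (hx : x ∈ C) (hy : y ∈ C)
    (hmin : ∀ z ∈ C, dist p x + dist x q ≤ dist p z + dist z q) :
    ⟪direction x q - direction p x, y - x⟫ ≤ 0 := by
  set u := y - x with hu
  set L := ‖u‖ ^ 2 / (2 * ‖x - p‖) + ‖u‖ ^ 2 / (2 * ‖x - q‖) with hL
  have hL0 : 0 ≤ L := by positivity
  have key : ∀ t : ℝ, 0 < t → t ≤ 1 → ⟪direction x q - direction p x, u⟫ ≤ t * L := by
    intro t ht0 ht1
    have h1 := norm_add_smul_le (sub_ne_zero.2 hp.symm) u t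
    have h2 := norm_add_smul_le (sub_ne_zero.2 hq) u t
    have h3 := hmin _ (hC.add_smul_sub_mem hx hy ⟨ht0.le, ht1⟩)
    rw [dist_comm p, dist_comm p, dist_eq_norm, dist_eq_norm, dist_eq_norm, dist_eq_norm, ← hu,
      add_sub_right_comm x, add_sub_right_comm x] at h3
    have h4 : ‖x - q‖⁻¹ • (x - q) = - direction x q := by
      rw [direction, norm_sub_rev, ← smul_neg, neg_sub]
    have h5 : ‖x - p‖⁻¹ • (x - p) = direction p x := rfl
    rw [h5] at h1
    rw [h4, inner_neg_left] at h2
    rw [inner_sub_left]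
    have h6 : t * (⟪direction x q, u⟫ - ⟪direction p x, u⟫) ≤ t * (t * L) := by
      rw [hL]; linarith
    exact le_of_mul_le_mul_left h6 ht0
  by_contra! hpos
  set c := ⟪direction x q - direction p x, u⟫
  have h1 := key (min 1 (c / (2 * (L + 1)))) (by positivity) (min_le_left _ _)
  have h2 : min 1 (c / (2 * (L + 1))) * L ≤ c / (2 * (L + 1)) * (L + 1) := by
    gcongr
    · exact min_le_right _ _
    · linarith
  have h3 : c / (2 * (L + 1)) * (L + 1) = c / 2 := by field_simp
  linarith

/-- The converse of `inner_direction_sub_nonpos_of_minimal`, by convexity of the length. -/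
lemma minimal_of_inner_direction_sub_nonpos {p x q z : E}
    (h : ⟪direction x q - direction p x, z - x⟫ ≤ 0) :
    dist p x + dist x q ≤ dist p z + dist z q := by
  have h1 := inner_direction_le p x (z - p)
  have h2 := inner_direction_le x q (q - z)
  have h3 := inner_direction_sub p x
  have h4 := inner_direction_sub x q
  rw [show z - p = (z - x) + (x - p) by abel, inner_add_right] at h1
  rw [show q - z = (q - x) - (z - x) by abel, inner_sub_right] at h2
  rw [inner_sub_left] at h
  rw [dist_comm p x, dist_comm x q, dist_comm p z, dist_comm z q, dist_eq_norm, dist_eq_norm,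
    dist_eq_norm, dist_eq_norm]
  have e1 : z - x + (x - p) = z - p := by abel
  have e2 : q - x - (z - x) = q - z := by abel
  rw [e1] at h1
  rw [e2] at h2
  linarith

lemma tendsto_add_smul (x u : E) : Tendsto (fun t : ℝ => x + t • u) (𝓝[>] 0) (𝓝 x) := by
  have : Tendsto (fun t : ℝ => x + t • u) (𝓝 0) (𝓝 (x + (0 : ℝ) • u)) :=
    Continuous.tendsto (by fun_prop) 0
  rw [zero_smul, add_zero] at this
  exact this.mono_left nhdsWithin_le_nhds

lemma inner_sub_neg_of_mem_interior {C : Set E} {x z m : E} (hm : m ≠ 0)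
    (h : ∀ y ∈ C, ⟪m, y - x⟫ ≤ 0) (hz : z ∈ interior C) : ⟪m, z - x⟫ < 0 := by
  obtain ⟨t, ht, ht0⟩ := (((tendsto_add_smul z m).eventually (mem_interior_iff_mem_nhds.1 hz)).and
    self_mem_nhdsWithin).exists
  have h1 := h _ ht
  rw [show z + t • m - x = (z - x) + t • m by abel, inner_add_right, real_inner_smul_right,
    real_inner_self_eq_norm_sq] at h1
  have h2 : 0 < t * ‖m‖ ^ 2 := mul_pos ht0 (pow_pos (norm_pos_iff.2 hm) 2)
  linarith

/-- A normal vector of a strictly convex set at `x` is maximised at `x` only. -/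
lemma inner_sub_neg_of_strictConvex {C : Set E} (hC : StrictConvex ℝ C) {x y m : E} (hm : m ≠ 0)
    (h : ∀ z ∈ C, ⟪m, z - x⟫ ≤ 0) (hx : x ∈ C) (hy : y ∈ C) (hxy : x ≠ y) :
    ⟪m, y - x⟫ < 0 := by
  have h1 := inner_sub_neg_of_mem_interior hm h
    (hC hx hy hxy (show (0 : ℝ) < 1 / 2 by norm_num) (show (0 : ℝ) < 1 / 2 by norm_num)
      (by norm_num))
  rw [show (1 / 2 : ℝ) • x + (1 / 2 : ℝ) • y - x = (1 / 2 : ℝ) • (y - x) by module,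
    real_inner_smul_right] at h1
  linarith

lemma continuousOn_direction {X : Type*} [TopologicalSpace X] {f g : X → E} {S : Set X}
    (hf : Continuous f) (hg : Continuous g) (h : ∀ z ∈ S, f z ≠ g z) :
    ContinuousOn (fun z => direction (f z) (g z)) S := by
  have hfg : Continuous fun z => g z - f z := hg.sub hf
  exact (hfg.norm.continuousOn.inv₀ fun z hz =>
    norm_ne_zero_iff.2 (sub_ne_zero.2 (h z hz).symm)).smul hfg.continuousOn

end Direction

/-! ### Chains of locally minimal length -/

section Chain

variable {K : Fin s → Set (Euc N)}

local notation "⟪" x ", " y "⟫" => inner ℝ x y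

/-- `x` is a bi-infinite chain of points of the obstacles in the order prescribed by `ξ`, each of
which minimises the length of the path through its two neighbours. -/
def IsMinimalChain (K : Fin s → Set (Euc N)) (ξ : SymbolSpace s) (x : ℤ → Euc N) : Prop :=
  ∀ i, x i ∈ K (ξ.1 i) ∧ ∀ y ∈ K (ξ.1 i),
    dist (x (i - 1)) (x i) + dist (x i) (x (i + 1)) ≤ dist (x (i - 1)) y + dist y (x (i + 1))

/-- The change of direction of a chain at its `i`-th point. -/
noncomputable def turn (x : ℤ → Euc N) (i : ℤ) : Euc N :=
  direction (x i) (x (i + 1)) - direction (x (i - 1)) (x i)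

lemma ne_succ_of_mem (hK : IsOpenBilliard K) {ξ : SymbolSpace s} {x : ℤ → Euc N}
    (hx : ∀ i, x i ∈ K (ξ.1 i)) (i : ℤ) : x i ≠ x (i + 1) := fun h =>
  disjoint_left.1 (hK.pairwiseDisjoint (ξ.2 i)) (hx i) (h ▸ hx (i + 1))

lemma pred_ne_of_mem (hK : IsOpenBilliard K) {ξ : SymbolSpace s} {x : ℤ → Euc N}
    (hx : ∀ i, x i ∈ K (ξ.1 i)) (i : ℤ) : x (i - 1) ≠ x i := by
  simpa using ne_succ_of_mem hK hx (i - 1)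

lemma segment_disjoint (hK : IsOpenBilliard K) {i j k : Fin s} (hi : k ≠ i) (hj : k ≠ j)
    {x y z : Euc N} (hx : x ∈ K i) (hy : y ∈ K j) (hz : z ∈ segment ℝ x y) : z ∉ K k :=
  disjoint_left.1 (hK.noEclipse i j k hi hj)
    (segment_subset_convexHull (subset_union_left hx) (subset_union_right hy) hz)

/-- By the no-eclipse condition a chain does not go straight on. -/
lemma turn_ne_zero (hK : IsOpenBilliard K) {ξ : SymbolSpace s} {x : ℤ → Euc N}
    (hx : ∀ i, x i ∈ K (ξ.1 i)) (i : ℤ) : turn x i ≠ 0 := by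
  intro h
  have h1 : SameRay ℝ (x i - x (i - 1)) (x (i + 1) - x i) :=
    (sameRay_iff_inv_norm_smul_eq_of_ne (sub_ne_zero.2 (pred_ne_of_mem hK hx i).symm)
      (sub_ne_zero.2 (ne_succ_of_mem hK hx i).symm)).2 (sub_eq_zero.1 h).symm
  have h2 := ξ.2 (i - 1)
  rw [sub_add_cancel] at h2
  exact segment_disjoint hK h2.symm (ξ.2 i) (hx (i - 1)) (hx (i + 1))
    (mem_segment_iff_sameRay.2 h1) (hx i)

/-- For chains of obstacle points, minimality is equivalent to the first-order condition. -/
lemma isMinimalChain_iff (hK : IsOpenBilliard K) {ξ : SymbolSpace s} {x : ℤ → Euc N} :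
    IsMinimalChain K ξ x ↔
      ∀ i, x i ∈ K (ξ.1 i) ∧ ∀ y ∈ K (ξ.1 i), ⟪turn x i, y - x i⟫ ≤ 0 := by
  refine ⟨fun h i => ⟨(h i).1, fun y hy => ?_⟩, fun h i => ⟨(h i).1, fun y hy => ?_⟩⟩
  · exact inner_direction_sub_nonpos_of_minimal (hK.strictConvex _).convex
      (pred_ne_of_mem hK (fun j => (h j).1) i) (ne_succ_of_mem hK (fun j => (h j).1) i)
      (h i).1 hy (h i).2
  · exact minimal_of_inner_direction_sub_nonpos ((h i).2 y hy)

/-- Translation of a symbol sequence by an arbitrary integer. -/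
def translate (j : ℤ) (ξ : SymbolSpace s) : SymbolSpace s :=
  ⟨fun i => ξ.1 (i + j), fun i => by
    dsimp only
    rw [add_right_comm]
    exact ξ.2 (i + j)⟩

lemma IsMinimalChain.translate {ξ : SymbolSpace s} {x : ℤ → Euc N} (h : IsMinimalChain K ξ x)
    (j : ℤ) : IsMinimalChain K (translate j ξ) fun i => x (i + j) := fun i => by
  dsimp only
  rw [sub_add_eq_add_sub, add_right_comm i 1 j]
  exact h (i + j)

lemma isClosed_setOf_isMinimalChain (hK : IsOpenBilliard K) :
    IsClosed {p : SymbolSpace s × (ℤ → Euc N) | IsMinimalChain K p.1 p.2} := by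
  have : {p : SymbolSpace s × (ℤ → Euc N) | IsMinimalChain K p.1 p.2} =
      ⋂ (i : ℤ) (a : Fin s), {p | p.1.1 i = a → p ∈ {p : SymbolSpace s × (ℤ → Euc N) |
        p.2 i ∈ K a} ∩ ⋂ y ∈ K a, {p | dist (p.2 (i - 1)) (p.2 i) + dist (p.2 i) (p.2 (i + 1)) ≤
          dist (p.2 (i - 1)) y + dist y (p.2 (i + 1))}} := by
    ext p
    simp only [IsMinimalChain, mem_inter_iff, mem_iInter, mem_ofPred_eq]
    exact forall_congr' fun i => ⟨fun h a ha => ha ▸ h, fun h => h _ rfl⟩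
  rw [this]
  refine isClosed_iInter fun i => isClosed_iInter fun a => isClosed_imp ?_ (IsClosed.inter ?_
    (isClosed_iInter fun y => isClosed_iInter fun _ => isClosed_le (by fun_prop) (by fun_prop)))
  · exact (isOpen_discrete ({a} : Set (Fin s))).preimage
      ((continuous_symbol i).comp continuous_fst)
  · exact (hK.isCompact a).isClosed.preimage (by fun_prop)

lemma isCompact_obstacle (hK : IsOpenBilliard K) : IsCompact (obstacle K) :=
  isCompact_iUnion hK.isCompact

lemma isCompact_setOf_isMinimalChain (hK : IsOpenBilliard K) :
    IsCompact {p : SymbolSpace s × (ℤ → Euc N) | IsMinimalChain K p.1 p.2} :=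
  (isCompact_univ.prod (isCompact_univ_pi fun _ => isCompact_obstacle hK)).of_isClosed_subset
    (isClosed_setOf_isMinimalChain hK)
    fun _ hp => ⟨mem_univ _, fun i _ => mem_iUnion.2 ⟨_, (hp i).1⟩⟩

/-! ### Uniqueness of chains -/

/-- The separation of two chains at time `i`, measured by pairing the difference of their
directions with the difference of their points. -/
noncomputable def separation (x y : ℤ → Euc N) (i : ℤ) : ℝ :=
  ⟪direction (x i) (x (i + 1)) - direction (y i) (y (i + 1)), x i - y i⟫

/-- The separation of two chains with the same symbols does not decrease in time: it does not
decrease in free flight by monotonicity of the gradient of the norm, nor at a reflection by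
convexity of the obstacle, and strictly increases at a reflection if the points differ. -/
lemma separation_le_succ (hK : IsOpenBilliard K) {ξ : SymbolSpace s} {x y : ℤ → Euc N}
    (hx : IsMinimalChain K ξ x) (hy : IsMinimalChain K ξ y) (i : ℤ) :
    separation x y i ≤ separation x y (i + 1) ∧
      (separation x y i = separation x y (i + 1) → x (i + 1) = y (i + 1)) := by
  rw [isMinimalChain_iff hK] at hx hy
  have h1 := inner_direction_sub_direction_nonneg (x i) (x (i + 1)) (y i) (y (i + 1))
  have h2 := (hx (i + 1)).2 _ (hy (i + 1)).1
  have h3 := (hy (i + 1)).2 _ (hx (i + 1)).1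
  have key : separation x y (i + 1) - separation x y i =
      ⟪direction (x i) (x (i + 1)) - direction (y i) (y (i + 1)),
        (x (i + 1) - x i) - (y (i + 1) - y i)⟫ - ⟪turn x (i + 1), y (i + 1) - x (i + 1)⟫
        - ⟪turn y (i + 1), x (i + 1) - y (i + 1)⟫ := by
    simp only [separation, turn, add_sub_cancel_right, inner_sub_left, inner_sub_right]
    ring
  refine ⟨by linarith, fun heq => ?_⟩
  by_contra hne
  have h4 := inner_sub_neg_of_strictConvex (hK.strictConvex _)
    (turn_ne_zero hK (fun j => (hx j).1) (i + 1)) (hx (i + 1)).2 (hx (i + 1)).1 (hy (i + 1)).1 hne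
  linarith

lemma separation_eq_zero {x y : ℤ → Euc N} {i : ℤ} (h : x i = y i) : separation x y i = 0 := by
  rw [separation, h, sub_self, inner_zero_right]

lemma separation_translate (x y : ℤ → Euc N) (j : ℤ) :
    separation (fun i => x (i + j)) (fun i => y (i + j)) 0 = separation x y j := by
  simp only [separation]
  rw [zero_add, zero_add, add_comm 1 j]

/-- The pairs of minimal chains with the same symbols, together with these symbols. -/
def chainPairs (K : Fin s → Set (Euc N)) : Set (SymbolSpace s × (ℤ → Euc N) × (ℤ → Euc N)) :=
  {p | IsMinimalChain K p.1 p.2.1 ∧ IsMinimalChain K p.1 p.2.2}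

lemma isCompact_chainPairs (hK : IsOpenBilliard K) : IsCompact (chainPairs K) := by
  refine (isCompact_univ.prod ((isCompact_univ_pi fun _ => isCompact_obstacle hK).prod
    (isCompact_univ_pi fun _ => isCompact_obstacle hK))).of_isClosed_subset ?_
    fun p hp => ⟨mem_univ _, fun i _ => mem_iUnion.2 ⟨_, (hp.1 i).1⟩,
      fun i _ => mem_iUnion.2 ⟨_, (hp.2 i).1⟩⟩
  have hc := isClosed_setOf_isMinimalChain hK
  exact (hc.preimage (by fun_prop : Continuous
      fun p : SymbolSpace s × (ℤ → Euc N) × (ℤ → Euc N) => (p.1, p.2.1))).inter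
    (hc.preimage (by fun_prop : Continuous
      fun p : SymbolSpace s × (ℤ → Euc N) × (ℤ → Euc N) => (p.1, p.2.2)))

lemma continuousOn_separation (hK : IsOpenBilliard K) :
    ContinuousOn (fun p : SymbolSpace s × (ℤ → Euc N) × (ℤ → Euc N) =>
      separation p.2.1 p.2.2 0) (chainPairs K) := by
  refine ContinuousOn.inner (ContinuousOn.sub ?_ ?_) (Continuous.continuousOn (by fun_prop))
  · exact continuousOn_direction (by fun_prop) (by fun_prop)
      fun p hp => ne_succ_of_mem hK (fun j => (hp.1 j).1) 0
  · exact continuousOn_direction (by fun_prop) (by fun_prop)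
      fun p hp => ne_succ_of_mem hK (fun j => (hp.2 j).1) 0

/-- At a pair of chains where the separation at time `0` is maximal it does not increase in the
next step, so the next points agree and the maximum is `0`. -/
lemma separation_nonpos (hK : IsOpenBilliard K) {ξ : SymbolSpace s} {x y : ℤ → Euc N}
    (hx : IsMinimalChain K ξ x) (hy : IsMinimalChain K ξ y) (i : ℤ) : separation x y i ≤ 0 := by
  obtain ⟨⟨ξ', x', y'⟩, hp, hmax⟩ := (isCompact_chainPairs hK).exists_isMaxOn
    ⟨(ξ, x, y), hx, hy⟩ (continuousOn_separation hK)
  obtain ⟨hx', hy'⟩ : IsMinimalChain K ξ' x' ∧ IsMinimalChain K ξ' y' := hp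
  have hle : ∀ {ξ x y}, IsMinimalChain K ξ x → IsMinimalChain K ξ y → ∀ i,
      separation x y i ≤ separation x' y' 0 := fun {ξ x y} hx hy i => by
    rw [← separation_translate x y i]
    exact isMaxOn_iff.1 hmax (OpenBilliard.translate i ξ, _, _) ⟨hx.translate i, hy.translate i⟩
  have h := separation_le_succ hK hx' hy' 0
  have heq := le_antisymm h.1 (hle hx' hy' _)
  rw [separation_eq_zero (h.2 heq)] at heq
  exact (hle hx hy i).trans heq.le

lemma separation_nonneg (hK : IsOpenBilliard K) {ξ : SymbolSpace s} {x y : ℤ → Euc N}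
    (hx : IsMinimalChain K ξ x) (hy : IsMinimalChain K ξ y) (i : ℤ) : 0 ≤ separation x y i := by
  obtain ⟨⟨ξ', x', y'⟩, hp, hmin⟩ := (isCompact_chainPairs hK).exists_isMinOn
    ⟨(ξ, x, y), hx, hy⟩ (continuousOn_separation hK)
  obtain ⟨hx', hy'⟩ : IsMinimalChain K ξ' x' ∧ IsMinimalChain K ξ' y' := hp
  have hge : ∀ {ξ x y}, IsMinimalChain K ξ x → IsMinimalChain K ξ y → ∀ i,
      separation x' y' 0 ≤ separation x y i := fun {ξ x y} hx hy i => by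
    rw [← separation_translate x y i]
    exact isMinOn_iff.1 hmin (OpenBilliard.translate i ξ, _, _) ⟨hx.translate i, hy.translate i⟩
  have h := separation_le_succ hK hx' hy' (-1)
  rw [neg_add_cancel] at h
  exact (separation_eq_zero (h.2 (le_antisymm h.1 (hge hx' hy' _)))).ge.trans (hge hx hy i)

/-- A sequence of symbols has at most one minimal chain: the separation of two chains vanishes at
all times, and where it does not increase the chains agree. -/
lemma IsMinimalChain.unique (hK : IsOpenBilliard K) {ξ : SymbolSpace s} {x y : ℤ → Euc N}
    (hx : IsMinimalChain K ξ x) (hy : IsMinimalChain K ξ y) : x = y := by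
  have h0 : ∀ i, separation x y i = 0 := fun i =>
    le_antisymm (separation_nonpos hK hx hy i) (separation_nonneg hK hx hy i)
  funext i
  have h := (separation_le_succ hK hx hy (i - 1)).2 (by rw [h0, h0])
  rwa [sub_add_cancel] at h

/-! ### Existence of chains -/

/-- Points that minimise the total length over a finite window are locally minimal in its
interior. -/
lemma exists_minimal_on_window (hK : IsOpenBilliard K) (ξ : SymbolSpace s) (n : ℕ) :
    ∃ x : ℤ → Euc N, (∀ i, x i ∈ K (ξ.1 i)) ∧ ∀ i : ℤ, |i| < n → ∀ y ∈ K (ξ.1 i),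
      dist (x (i - 1)) (x i) + dist (x i) (x (i + 1)) ≤
        dist (x (i - 1)) y + dist y (x (i + 1)) := by
  have hcomp : IsCompact (Set.pi univ fun i => K (ξ.1 i)) :=
    isCompact_univ_pi fun i => hK.isCompact _
  have hne : (Set.pi univ fun i => K (ξ.1 i)).Nonempty :=
    univ_pi_nonempty_iff.2 fun i => hK.nonempty _
  have hcont : Continuous fun x : ℤ → Euc N =>
      ∑ i ∈ Finset.Ico (-n : ℤ) n, dist (x i) (x (i + 1)) :=
    continuous_finsetSum _ fun i _ => by fun_prop
  obtain ⟨x, hx, hmin⟩ := hcomp.exists_isMinOn hne hcont.continuousOn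
  refine ⟨x, fun i => hx i (mem_univ i), fun i hi y hy => ?_⟩
  rw [abs_lt] at hi
  have hmem : Function.update x i y ∈ Set.pi univ fun i => K (ξ.1 i) := by
    intro j _
    by_cases hj : j = i
    · subst hj
      simpa using hy
    · simpa [hj] using hx j (mem_univ j)
  have h := hmin hmem
  rw [mem_ofPred_eq, ← sub_nonneg, ← Finset.sum_sub_distrib] at h
  have hsub : ({i - 1, i} : Finset ℤ) ⊆ Finset.Ico (-n : ℤ) n := fun j hj => by
    simp only [Finset.mem_insert, Finset.mem_singleton] at hj
    rw [Finset.mem_Ico]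
    omega
  rw [← Finset.sum_subset hsub, Finset.sum_pair (by omega), sub_add_cancel,
    Function.update_self, Function.update_of_ne (by omega), Function.update_of_ne (by omega)] at h
  · linarith
  · intro j _ hj
    simp only [Finset.mem_insert, Finset.mem_singleton, not_or] at hj
    rw [Function.update_of_ne hj.2, Function.update_of_ne (by omega), sub_self]

lemma exists_isMinimalChain (hK : IsOpenBilliard K) (ξ : SymbolSpace s) :
    ∃ x, IsMinimalChain K ξ x := by
  let F : ℕ → Set (ℤ → Euc N) := fun n => (Set.pi univ fun i => K (ξ.1 i)) ∩
    ⋂ (i : ℤ) (_ : |i| < n), ⋂ y ∈ K (ξ.1 i), {x | dist (x (i - 1)) (x i) + dist (x i) (x (i + 1)) ≤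
        dist (x (i - 1)) y + dist y (x (i + 1))}
  have hclosed : ∀ n, IsClosed (F n) := fun n => by
    refine IsClosed.inter (isClosed_set_pi fun i _ => (hK.isCompact _).isClosed) ?_
    exact isClosed_iInter fun i => isClosed_iInter fun _ => isClosed_iInter fun y =>
      isClosed_iInter fun _ => isClosed_le (by fun_prop) (by fun_prop)
  obtain ⟨x, hx⟩ := IsCompact.nonempty_iInter_of_sequence_nonempty_isCompact_isClosed F
    (fun n x hx => ⟨hx.1, by
      have := hx.2
      simp only [mem_iInter] at this ⊢
      exact fun i hi => this i (hi.trans (by push_cast; linarith))⟩)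
    (fun n => by
      obtain ⟨x, h1, h2⟩ := exists_minimal_on_window hK ξ n
      refine ⟨x, fun i _ => h1 i, ?_⟩
      simp only [mem_iInter]
      exact h2)
    ((isCompact_univ_pi fun i => hK.isCompact _).of_isClosed_subset (hclosed 0)
      inter_subset_left) hclosed
  rw [mem_iInter] at hx
  refine ⟨x, fun i => ⟨(hx 0).1 i (mem_univ i), ?_⟩⟩
  have h := (hx (i.natAbs + 1)).2
  simp only [mem_iInter] at h
  exact h i (by push_cast; linarith)

/-- The points of the minimal chain depend continuously on the symbols, since the set of minimal
chains is compact and has one element for every symbol sequence. -/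
lemma continuous_of_isMinimalChain (hK : IsOpenBilliard K) {φ : SymbolSpace s → Euc N}
    (h : ∀ ξ, ∃ x, IsMinimalChain K ξ x ∧ x 0 = φ ξ) : Continuous φ := by
  refine continuous_iff_isClosed.2 fun F hF => ?_
  have : φ ⁻¹' F = Prod.fst '' ({p : SymbolSpace s × (ℤ → Euc N) | IsMinimalChain K p.1 p.2} ∩
      {p | p.2 0 ∈ F}) := by
    ext ξ
    constructor
    · intro hξ
      obtain ⟨x, hx, hx0⟩ := h ξ
      exact ⟨(ξ, x), ⟨hx, show x 0 ∈ F by rwa [hx0]⟩, rfl⟩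
    · rintro ⟨⟨η, y⟩, ⟨hy, hy0⟩, rfl⟩
      obtain ⟨x, hx, hx0⟩ := h η
      rw [mem_preimage, ← hx0, hx.unique hK hy]
      exact hy0
  rw [this]
  exact (((isCompact_setOf_isMinimalChain hK).inter_right
    (hF.preimage (by fun_prop))).image continuous_fst).isClosed

end Chain

/-! ### Outer unit normals -/

section Normal

variable {S : Set (Euc N)} {x ν ν' : Euc N}

local notation "⟪" x ", " y "⟫" => inner ℝ x y

lemma IsDefiningFunction.eq_zero {f : Euc N → ℝ} (h : IsDefiningFunction S x f)
    (hx : x ∈ frontier S) : f x = 0 := by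
  have hcont : ContinuousAt f x := h.contDiffAt.continuousAt
  rcases lt_trichotomy (f x) 0 with hlt | heq | hgt
  · refine absurd (mem_interior_iff_mem_nhds.2 ?_) hx.2
    filter_upwards [hcont.eventually (gt_mem_nhds hlt), h.mem_iff] with y hy hS
    exact hS.2 (le_of_lt hy)
  · exact heq
  · refine absurd hx.1 ?_
    rw [mem_closure_iff_frequently, not_frequently]
    filter_upwards [hcont.eventually (lt_mem_nhds hgt), h.mem_iff] with y hy hS hyS
    exact absurd (hS.1 hyS) (not_le.2 hy)

lemma IsDefiningFunction.tendsto_slope {f : Euc N → ℝ} (h : IsDefiningFunction S x f)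
    (hx : x ∈ frontier S) (u : Euc N) :
    Tendsto (fun t : ℝ => t⁻¹ * f (x + t • u)) (𝓝[>] 0) (𝓝 ⟪gradient f x, u⟫) := by
  have hd : HasFDerivAt f (InnerProductSpace.toDual ℝ _ (gradient f x)) (x + (0 : ℝ) • u) := by
    rw [zero_smul, add_zero]
    exact (h.contDiffAt.differentiableAt (by norm_num)).hasGradientAt.hasFDerivAt
  have hl : HasDerivAt (fun t : ℝ => x + t • u) u 0 := by
    simpa using ((hasDerivAt_id (0 : ℝ)).smul_const u).const_add x
  have hc := hasDerivAt_iff_tendsto_slope.1 (hd.comp_hasDerivAt (0 : ℝ) hl)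
  rw [InnerProductSpace.toDual_apply_apply] at hc
  refine (hc.mono_left (nhdsWithin_mono _ fun t ht => ne_of_gt ht)).congr fun t => ?_
  simp [slope_def_field, h.eq_zero hx, div_eq_inv_mul]

lemma IsOuterUnitNormal.eventually_mem (h : IsOuterUnitNormal S x ν) {u : Euc N}
    (hu : ⟪ν, u⟫ < 0) : ∀ᶠ t : ℝ in 𝓝[>] 0, x + t • u ∈ S := by
  obtain ⟨hx, -, f, hf, c, hc, hg⟩ := h
  have hlt : ⟪gradient f x, u⟫ < 0 := by
    rw [hg, real_inner_smul_left]
    exact mul_neg_of_pos_of_neg hc hu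
  filter_upwards [(hf.tendsto_slope hx u).eventually (gt_mem_nhds hlt), self_mem_nhdsWithin,
    (tendsto_add_smul x u).eventually hf.mem_iff] with t ht ht0 hS
  exact hS.2 (neg_of_mul_neg_right ht (inv_pos.2 ht0).le).le

lemma IsOuterUnitNormal.eventually_notMem (h : IsOuterUnitNormal S x ν) {u : Euc N}
    (hu : 0 < ⟪ν, u⟫) : ∀ᶠ t : ℝ in 𝓝[>] 0, x + t • u ∉ S := by
  obtain ⟨hx, -, f, hf, c, hc, hg⟩ := h
  have hlt : 0 < ⟪gradient f x, u⟫ := by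
    rw [hg, real_inner_smul_left]
    exact mul_pos hc hu
  filter_upwards [(hf.tendsto_slope hx u).eventually (lt_mem_nhds hlt), self_mem_nhdsWithin,
    (tendsto_add_smul x u).eventually hf.mem_iff] with t ht ht0 hS hmem
  exact absurd (hS.1 hmem) (not_le.2 (pos_of_mul_pos_right ht (inv_pos.2 ht0).le))

/-- A unit vector is determined by the open half-space in which its inner product is negative. -/
lemma eq_of_forall_inner_nonpos {a b : Euc N} (ha : ‖a‖ = 1) (hb : ‖b‖ = 1)
    (h : ∀ u, ⟪a, u⟫ < 0 → ⟪b, u⟫ ≤ 0) : a = b := by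
  by_contra hne
  have h1 : ⟪a, b⟫ < 1 := (inner_lt_one_iff_real_of_norm_eq_one ha hb).2 hne
  have h2 := h (b - a) (by
    rw [inner_sub_right, real_inner_self_eq_norm_sq, ha]
    linarith)
  rw [inner_sub_right, real_inner_self_eq_norm_sq, hb, real_inner_comm] at h2
  linarith

lemma IsOuterUnitNormal.unique (h : IsOuterUnitNormal S x ν) (h' : IsOuterUnitNormal S x ν') :
    ν = ν' := by
  refine eq_of_forall_inner_nonpos h.2.1 h'.2.1 fun u hu => ?_
  by_contra! hpos
  obtain ⟨t, h1, h2⟩ := ((h.eventually_mem hu).and (h'.eventually_notMem hpos)).exists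
  exact h2 h1

/-- The outer unit normal of a set is a normal vector of each of its convex subsets. -/
lemma IsOuterUnitNormal.inner_sub_nonpos (h : IsOuterUnitNormal S x ν) {C : Set (Euc N)}
    (hCS : C ⊆ S) (hC : Convex ℝ C) (hx : x ∈ C) {y : Euc N} (hy : y ∈ C) :
    ⟪ν, y - x⟫ ≤ 0 := by
  by_contra! hpos
  obtain ⟨t, h1, ht⟩ := ((h.eventually_notMem hpos).and
    (Ioo_mem_nhdsGT (show (0 : ℝ) < 1 by norm_num))).exists
  exact h1 (hCS (hC.add_smul_sub_mem hx hy ⟨ht.1.le, ht.2.le⟩))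

/-- Conversely, a nonzero normal vector of a subset that agrees with the set near `x` is a positive
multiple of the outer unit normal. -/
lemma IsOuterUnitNormal.eq_norm_smul (h : IsOuterUnitNormal S x ν) {C : Set (Euc N)}
    (hCS : ∀ᶠ y in 𝓝 x, y ∈ S → y ∈ C) {m : Euc N} (hm : m ≠ 0)
    (hmC : ∀ y ∈ C, ⟪m, y - x⟫ ≤ 0) : m = ‖m‖ • ν := by
  have hm' : ‖m‖ ≠ 0 := norm_ne_zero_iff.2 hm
  have key : ν = ‖m‖⁻¹ • m := by
    refine eq_of_forall_inner_nonpos h.2.1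
      (by rw [norm_smul, norm_inv, norm_norm, inv_mul_cancel₀ hm']) fun u hu => ?_
    obtain ⟨t, ⟨ht, htC⟩, ht0⟩ := (((h.eventually_mem hu).and
      ((tendsto_add_smul x u).eventually hCS)).and self_mem_nhdsWithin).exists
    have h1 := hmC _ (htC ht)
    rw [add_sub_cancel_left, real_inner_smul_right] at h1
    rw [real_inner_smul_left]
    exact mul_nonpos_of_nonneg_of_nonpos (by positivity)
      (nonpos_of_mul_nonpos_right h1 ht0)
  rw [key, smul_inv_smul₀ hm']

variable {K : Fin s → Set (Euc N)}

lemma isClosed_obstacle (hK : IsOpenBilliard K) : IsClosed (obstacle K) :=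
  (isCompact_obstacle hK).isClosed

lemma subset_obstacle (K : Fin s → Set (Euc N)) (a : Fin s) : K a ⊆ obstacle K :=
  subset_iUnion K a

lemma eventually_mem_obstacle_iff (hK : IsOpenBilliard K) {a : Fin s} (hx : x ∈ K a) :
    ∀ᶠ y in 𝓝 x, y ∈ obstacle K ↔ y ∈ K a := by
  have hclosed : IsClosed (⋃ b ∈ {b | b ≠ a}, K b) :=
    (toFinite _).isClosed_biUnion fun b _ => (hK.isCompact b).isClosed
  have hnot : x ∉ ⋃ b ∈ {b | b ≠ a}, K b := by
    simp only [mem_iUnion, not_exists]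
    exact fun b hb hxb => disjoint_left.1 (hK.pairwiseDisjoint hb) hxb hx
  filter_upwards [hclosed.isOpen_compl.mem_nhds hnot] with y hy
  refine ⟨fun h => ?_, fun h => subset_obstacle K a h⟩
  obtain ⟨b, hb⟩ := mem_iUnion.1 h
  by_cases hba : b = a
  · exact hba ▸ hb
  · exact absurd (mem_iUnion₂.2 ⟨b, hba, hb⟩) hy

lemma exists_isOuterUnitNormal (hK : IsOpenBilliard K) {a : Fin s} (hx : x ∈ K a)
    (hint : x ∉ interior (K a)) : ∃ ν, IsOuterUnitNormal (obstacle K) x ν := by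
  have hnear := eventually_mem_obstacle_iff hK hx
  obtain ⟨f, hf⟩ := hK.hasC2Boundary a x ⟨subset_closure hx, hint⟩
  have hg : 0 < ‖gradient f x‖ := norm_pos_iff.2 hf.gradient_ne_zero
  refine ⟨‖gradient f x‖⁻¹ • gradient f x, ⟨subset_closure (subset_obstacle K a hx), ?_⟩, ?_,
    f, ⟨hf.contDiffAt, hf.gradient_ne_zero, ?_⟩, ‖gradient f x‖, hg,
    (smul_inv_smul₀ hg.ne' _).symm⟩
  · rw [mem_interior_iff_mem_nhds] at hint ⊢
    refine fun h => hint ?_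
    filter_upwards [h, hnear] with y hy hiff using hiff.1 hy
  · rw [norm_smul, norm_inv, norm_norm, inv_mul_cancel₀ hg.ne']
  · filter_upwards [hf.mem_iff, hnear] with y h1 h2 using h2.trans h1

end Normal

/-! ### Billiard trajectories and minimal chains -/

section Trajectory

variable {K : Fin s → Set (Euc N)} {ξ : SymbolSpace s}

local notation "⟪" x ", " y "⟫" => inner ℝ x y

/-- The reflection points of a billiard trajectory form a minimal chain, since the change of
direction at a reflection is a positive multiple of the outer unit normal. -/
lemma IsCodedBy.exists_isMinimalChain (hK : IsOpenBilliard K) {q : Euc N × Euc N}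
    (h : IsCodedBy K ξ q) :
    ∃ x, IsMinimalChain K ξ x ∧ q = (x 0, direction (x 0) (x 1)) := by
  obtain ⟨o, rfl, ho⟩ := h
  have hmem : ∀ i, (o i).1 ∈ K (ξ.1 i) := fun i =>
    (hK.isCompact _).isClosed.frontier_subset (ho i).2
  have hdir : ∀ i, direction (o i).1 (o (i + 1)).1 = (o i).2 := fun i => by
    obtain ⟨⟨hnorm, -⟩, -, ⟨t, ht, heq⟩, -⟩ := (ho i).1
    rw [heq, direction_add_smul ht hnorm]
  refine ⟨fun i => (o i).1, (isMinimalChain_iff hK).2 fun i => ⟨hmem i, fun y hy => ?_⟩, ?_⟩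
  · have hprev := (ho (i - 1)).1
    have hdir' := hdir (i - 1)
    rw [sub_add_cancel] at hprev hdir'
    obtain ⟨-, ⟨-, ν', hν', hpos⟩, -, -, ν, hν, hrefl⟩ := hprev
    obtain rfl := hν.unique hν'
    have h1 : ⟪ν, (o i).2⟫ = -⟪(o (i - 1)).2, ν⟫ := by
      rw [hrefl, inner_sub_right, real_inner_smul_right, real_inner_self_eq_norm_sq, hν.2.1,
        real_inner_comm]
      ring
    have h2 : turn (fun i => (o i).1) i = (2 * ⟪ν, (o i).2⟫) • ν := by
      rw [turn, hdir, hdir', h1, hrefl]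
      module
    rw [h2, real_inner_smul_left]
    exact mul_nonpos_of_nonneg_of_nonpos (by linarith)
      (hν.inner_sub_nonpos (subset_obstacle K _) (hK.strictConvex _).convex (hmem i) hy)
  · have := hdir 0
    rw [zero_add] at this
    rw [this]

/-- The points of a minimal chain are the reflection points of a billiard trajectory. -/
lemma IsMinimalChain.isCodedBy (hK : IsOpenBilliard K) {x : ℤ → Euc N}
    (h : IsMinimalChain K ξ x) : IsCodedBy K ξ (x 0, direction (x 0) (x 1)) := by
  rw [isMinimalChain_iff hK] at h
  have hmem : ∀ i, x i ∈ K (ξ.1 i) := fun i => (h i).1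
  have hturn := turn_ne_zero hK hmem
  have hint : ∀ i, x i ∉ interior (K (ξ.1 i)) := fun i hi => by
    have := inner_sub_neg_of_mem_interior (hturn i) (h i).2 hi
    rw [sub_self, inner_zero_right] at this
    exact lt_irrefl _ this
  choose ν hν using fun i => exists_isOuterUnitNormal hK (hmem i) (hint i)
  have hturn_eq : ∀ i, turn x i = ‖turn x i‖ • ν i := fun i =>
    (hν i).eq_norm_smul ((eventually_mem_obstacle_iff hK (hmem i)).mono fun y hy => hy.1)
      (hturn i) (h i).2
  have hpos : ∀ i, 0 < ‖turn x i‖ := fun i => norm_pos_iff.2 (hturn i)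
  let v : ℤ → Euc N := fun i => direction (x i) (x (i + 1))
  have hnorm : ∀ i, ‖v i‖ = 1 := fun i => norm_direction (ne_succ_of_mem hK hmem i)
  have hv : ∀ i, v (i - 1) = v i - ‖turn x i‖ • ν i := fun i => by
    rw [← hturn_eq]
    simp only [v, turn, sub_add_cancel]
    abel
  -- The directions before and after a reflection have norm `1`, which determines their components
  -- along the normal.
  have hout : ∀ i, ⟪v i, ν i⟫ = ‖turn x i‖ / 2 := fun i => by
    have h1 : ‖v (i - 1)‖ ^ 2 = ‖v i‖ ^ 2 - 2 * (‖turn x i‖ * ⟪v i, ν i⟫) + ‖turn x i‖ ^ 2 := by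
      rw [hv, norm_sub_sq_real, real_inner_smul_right, norm_smul, (hν i).2.1, norm_norm, mul_one]
    rw [hnorm, hnorm] at h1
    have h2 : ‖turn x i‖ * (‖turn x i‖ - 2 * ⟪v i, ν i⟫) = 0 := by linarith
    rcases mul_eq_zero.1 h2 with h3 | h3
    · exact absurd h3 (hpos i).ne'
    · linarith
  have hin : ∀ i, ⟪v (i - 1), ν i⟫ = -(‖turn x i‖ / 2) := fun i => by
    rw [hv, inner_sub_left, hout, real_inner_smul_left, real_inner_self_eq_norm_sq, (hν i).2.1]
    ring
  have hphase : ∀ i, (x i, v i) ∈ phaseSpace K := fun i =>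
    ⟨hnorm i, ν i, hν i, by rw [real_inner_comm, hout]; linarith [hpos i]⟩
  refine ⟨fun i => (x i, v i), by simp [v], fun i => ⟨⟨hphase i, hphase (i + 1),
    ⟨‖x (i + 1) - x i‖, ?_, (add_norm_smul_direction _ _).symm⟩, ?_, ν (i + 1), hν _, ?_⟩,
    subset_closure (hmem i), hint i⟩⟩
  · exact norm_pos_iff.2 (sub_ne_zero.2 (ne_succ_of_mem hK hmem i).symm)
  · refine disjoint_left.2 fun z hz hzf => ?_
    obtain ⟨a, ha⟩ := mem_iUnion.1 ((isClosed_obstacle hK).frontier_subset hzf)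
    have hlen : 0 < ‖x (i + 1) - x i‖ :=
      norm_pos_iff.2 (sub_ne_zero.2 (ne_succ_of_mem hK hmem i).symm)
    have hsub : x (i + 1) - x i = ‖x (i + 1) - x i‖ • v i :=
      (eq_sub_of_add_eq' (add_norm_smul_direction (x i) (x (i + 1)))).symm
    obtain ⟨b, c, hb, hc, hbc, rfl⟩ := hz
    obtain rfl : b = 1 - c := by linarith
    by_cases ha1 : a = ξ.1 i
    -- The ray leaves the half-space of the normal that contains the first obstacle.
    · subst ha1
      have h1 := (h i).2 _ ha
      dsimp only at h1
      rw [show (1 - c) • x i + c • x (i + 1) - x i = c • (x (i + 1) - x i) by module, hsub,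
        hturn_eq i, real_inner_smul_left, real_inner_smul_right, real_inner_smul_right,
        real_inner_comm, hout] at h1
      have := hpos i
      exact absurd h1 (not_le.2 (by positivity))
    by_cases ha2 : a = ξ.1 (i + 1)
    -- The ray reaches the half-space that contains the second obstacle at its end only.
    · subst ha2
      have h1 := (h (i + 1)).2 _ ha
      have h2 := hin (i + 1)
      rw [add_sub_cancel_right] at h2
      dsimp only at h1
      rw [show (1 - c) • x i + c • x (i + 1) - x (i + 1) = (-(1 - c)) • (x (i + 1) - x i) by
          module, hsub, hturn_eq (i + 1), real_inner_smul_left, real_inner_smul_right,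
        real_inner_smul_right, real_inner_comm, h2] at h1
      have h3 : 0 < ‖turn x (i + 1)‖ * ((1 - c) * (‖x (i + 1) - x i‖ * (‖turn x (i + 1)‖ / 2))) :=
        mul_pos (hpos _) (mul_pos hb (mul_pos hlen (half_pos (hpos _))))
      linarith
    · exact segment_disjoint hK ha1 ha2 (hmem i) (hmem (i + 1))
        (openSegment_subset_segment ℝ _ _ ⟨1 - c, c, hb, hc, hbc, rfl⟩) ha
  · have h1 := hv (i + 1)
    have h2 := hin (i + 1)
    rw [add_sub_cancel_right] at h1 h2
    dsimp only
    rw [h2, h1]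
    module

lemma existsUnique_isCodedBy (hK : IsOpenBilliard K) (ξ : SymbolSpace s) :
    ∃! q, IsCodedBy K ξ q := by
  obtain ⟨x, hx⟩ := exists_isMinimalChain hK ξ
  refine ⟨_, hx.isCodedBy hK, fun q hq => ?_⟩
  obtain ⟨y, hy, rfl⟩ := hq.exists_isMinimalChain hK
  rw [hy.unique hK hx]

lemma continuous_observable (hK : IsOpenBilliard K) : Continuous (observable K) :=
  continuous_of_isMinimalChain hK fun ξ => by
    have h : IsCodedBy K ξ (coding K ξ) :=
      Classical.epsilon_spec (existsUnique_isCodedBy hK ξ).exists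
    obtain ⟨x, hx, hq⟩ := h.exists_isMinimalChain hK
    exact ⟨x, hx, by rw [observable, hq]⟩

end Trajectory

end OpenBilliard

theorem theorem1 {N s : ℕ} (hN : 2 ≤ N) (hs : 3 ≤ s)
    (K : Fin s → Set (OpenBilliard.Euc N)) (hK : OpenBilliard.IsOpenBilliard K) :
    (∀ ξ : OpenBilliard.SymbolSpace s, ∃! q, OpenBilliard.IsCodedBy K ξ q) ∧
    Convex ℝ (OpenBilliard.generalRotationSet (OpenBilliard.observable K)) ∧
    OpenBilliard.periodicConvexCombinations (OpenBilliard.observable K) ⊆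
      OpenBilliard.generalRotationSet (OpenBilliard.observable K) ∧
    OpenBilliard.generalRotationSet (OpenBilliard.observable K) ⊆
      closure (OpenBilliard.periodicConvexCombinations (OpenBilliard.observable K)) := by
  have hφ := OpenBilliard.continuous_observable hK
  have hG := OpenBilliard.generalRotationSet_eq_closure hs hφ
  have hconv := OpenBilliard.convex_closure_periodicRotationVectors hs hφ
  refine ⟨OpenBilliard.existsUnique_isCodedBy hK, hG ▸ hconv, ?_, ?_⟩
  · rw [hG]
    exact convexHull_min subset_closure hconv
  · rw [hG]
    exact closure_mono (subset_convexHull ℝ _)
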